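/- Let $n\ge 1$ and let $E=(\mathbb{C}^n,\|\cdot\|_E)$ and $F=(\mathbb{C}^n,\|\cdot\|_F)$ be $\mathbb{C}^n$ equipped with two norms. Write $\ell_2^n$ for $\mathbb{C}^n$ with the Euclidean norm, $X\hookrightarrow Y$ for the identity map of $\mathbb{C}^n$ regarded as an operator from $X$ to $Y$, and $\|\cdot\|$ for the operator norm. Say that $E$ has *enough symmetries in $\mathcal{O}(n)$*, where $\mathcal{O}(n)$ is the group of linear isometries of $\ell_2^n$ (the unitary $n\times n$ matrices), if there is a compact subgroup $G\subset\mathcal{O}(n)$ such that $\|u\|=\|gug'\|$ for all $u\in\mathcal{L}(E)$ and $g,g'\in G$, and such that every $u\in\mathcal{L}(E)$ with $ug=gu$ for all $g\in G$ is of the form $u=c\cdot\mathrm{id}_E$ with $c\in\mathbb{C}$. For an operator $T:X\to Y$ between complex Banach spaces let $\pi_2(T)$ be its absolutely $2$-summing norm, i.e. the infimum of all $\rho\ge 0$ such that $\bigl(\sum_{i=1}^m\|Tx_i\|^2\bigr)^{1/2}\le\rho\,\sup_{x'\in B_{X'}}\bigl(\sum_{i=1}^m|x'(x_i)|^2\bigr)^{1/2}$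 for all finite families $x_1,\dots,x_m\in X$ ($T$ is absolutely $2$-summing if such a $\rho$ exists). For $k\ge1$ let $x_k(T)=\sup\{a_k(TS) : S\in\mathcal{L}(\ell_2,X),\ \|S\|=1\}$ be its $k$-th Weyl number, where $a_k(R)=\inf\{\|R-L\| : \operatorname{rank}L<k\}$ is the $k$-th approximation number. Suppose that $E$ and $F$ both have enough symmetries in $\mathcal{O}(n)$ (possibly with respect to different groups). Then $E\hookrightarrow F$ is absolutely $2$-summing and $$\pi_2(E\hookrightarrow F)=n^{1/2}\cdot\frac{\|\ell_2^n\hookrightarrow F\|}{\|\ell_2^n\hookrightarrow E\|},$$ and for all integers $k$ with $1\le k\le n$ $$\Bigl(\frac{n-k+1}{n}\Bigr)^{1/2}\cdot\frac{\|\ell_2^n\hookrightarrow F\|}{\|\ell_2^n\hookrightarrow E\|}\;\le\; x_k(E\hookrightarrow F)\;\le\;\Bigl(\frac{n}{k}\Bigr)^{1/2}\cdot\frac{\|\ell_2^n\hookrightarrow F\|}{\|\ell_2^n\hookrightarrow E\|}.$$ -/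

import Mathlib

noncomputable section

namespace EnoughSymm

section Ideals

variable {E F : Type*} [NormedAddCommGroup E] [NormedSpace ℂ E]
  [NormedAddCommGroup F] [NormedSpace ℂ F]

/-- The weak `2`-norm `sup {(∑ |x'(x i)|²)^{1/2} : x' ∈ B_{E'}}` of a finite family in `E`
(a supremum over a nonempty, bounded set of reals). -/
def weakTwoNorm {m : ℕ} (x : Fin m → E) : ℝ :=
  ⨆ φ : Metric.closedBall (0 : StrongDual ℂ E) 1,
    √(∑ i, ‖(φ : StrongDual ℂ E) (x i)‖ ^ 2)

/-- `ρ` is an admissible constant in the definition of an absolutely `2`-summing operator. -/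
def IsTwoSummingBound (T : E →L[ℂ] F) (ρ : ℝ) : Prop :=
  0 ≤ ρ ∧ ∀ (m : ℕ) (x : Fin m → E), √(∑ i, ‖T (x i)‖ ^ 2) ≤ ρ * weakTwoNorm x

/-- `T` is absolutely `2`-summing. -/
def IsTwoSumming (T : E →L[ℂ] F) : Prop := ∃ ρ : ℝ, IsTwoSummingBound T ρ

/-- The `2`-summing norm `π₂(T)` (of an absolutely `2`-summing operator `T`). -/
def piTwo (T : E →L[ℂ] F) : ℝ := sInf {ρ : ℝ | IsTwoSummingBound T ρ}

/-- The `k`-th approximation number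
`a_k(T) = inf {‖T - L‖ : L bounded, linear, rank L < k}`, `k ≥ 1`. -/
def approxNumber (k : ℕ) (T : E →L[ℂ] F) : ℝ :=
  sInf {t : ℝ | ∃ L : E →L[ℂ] F,
    LinearMap.rank (L : E →ₗ[ℂ] F) < (k : Cardinal) ∧ t = ‖T - L‖}

/-- The complex Hilbert space `ℓ₂` of square summable sequences. -/
abbrev EllTwo : Type := lp (fun _ : ℕ => ℂ) 2

/-- The `k`-th Weyl number `x_k(T) = sup {a_k(T S) : S ∈ L(ℓ₂, E), ‖S‖ = 1}`, `k ≥ 1`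
(the set is bounded above by `‖T‖`). -/
def weylNumber (k : ℕ) (T : E →L[ℂ] F) : ℝ :=
  sSup {t : ℝ | ∃ S : EllTwo →L[ℂ] E, ‖S‖ = 1 ∧ t = approxNumber k (T ∘L S)}

end Ideals

/-- A norm on the complex vector space `ℂⁿ`. -/
structure CNorm (n : ℕ) extends Seminorm ℂ (Fin n → ℂ) where
  definite : ∀ x : Fin n → ℂ, toSeminorm x = 0 → x = 0

/-- The `n`-dimensional Banach space `(ℂⁿ, p)`. -/
def Space {n : ℕ} (_p : CNorm n) : Type := Fin n → ℂ

namespace Space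

variable {n : ℕ} (p : CNorm n)

instance : AddCommGroup (Space p) := inferInstanceAs (AddCommGroup (Fin n → ℂ))

instance : Module ℂ (Space p) := inferInstanceAs (Module ℂ (Fin n → ℂ))

instance : Norm (Space p) := ⟨fun x => p.toSeminorm x⟩

theorem core : NormedSpace.Core ℂ (Space p) where
  norm_nonneg x := apply_nonneg p.toSeminorm x
  norm_smul c x := map_smul_eq_mul p.toSeminorm c x
  norm_triangle x y := map_add_le_add p.toSeminorm x y
  norm_eq_zero_iff x := ⟨p.definite x, fun h => by rw [h]; exact map_zero p.toSeminorm⟩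

instance : NormedAddCommGroup (Space p) := NormedAddCommGroup.ofCore (core p)

instance : NormedSpace ℂ (Space p) := NormedSpace.ofCore (core p)

instance : FiniteDimensional ℂ (Space p) :=
  inferInstanceAs (FiniteDimensional ℂ (Fin n → ℂ))

/-- The tautological identification of `ℂⁿ` with the space `(ℂⁿ, p)`. -/
def ofVec : (Fin n → ℂ) ≃ₗ[ℂ] Space p := LinearEquiv.refl ℂ (Fin n → ℂ)

theorem norm_ofVec (x : Fin n → ℂ) : ‖ofVec p x‖ = p.toSeminorm x := rfl

end Space

variable {n : ℕ}

/-- The identity map `(ℂⁿ, p) ↪ (ℂⁿ, q)`. -/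
def idMap (p q : CNorm n) : Space p →L[ℂ] Space q :=
  LinearMap.toContinuousLinearMap
    ((Space.ofVec q).toLinearMap ∘ₗ (Space.ofVec p).symm.toLinearMap)

/-- The identity map `ℓ₂ⁿ ↪ (ℂⁿ, p)`. -/
def idMapL2 (p : CNorm n) : EuclideanSpace ℂ (Fin n) →L[ℂ] Space p :=
  LinearMap.toContinuousLinearMap
    ((Space.ofVec p).toLinearMap ∘ₗ (WithLp.linearEquiv 2 ℂ (Fin n → ℂ)).toLinearMap)

/-- A complex `n × n` matrix as an operator on `(ℂⁿ, p)`. -/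
def matOp (p : CNorm n) (A : Matrix (Fin n) (Fin n) ℂ) : Space p →L[ℂ] Space p :=
  LinearMap.toContinuousLinearMap
    ((Space.ofVec p).toLinearMap ∘ₗ Matrix.toLin' A ∘ₗ (Space.ofVec p).symm.toLinearMap)

/-- `(ℂⁿ, p)` has enough symmetries in the group of all linear isometries of `ℓ₂ⁿ`
(scalars are complex, so this is the group of unitary `n × n` matrices): there is a compact
subgroup `G` such that `‖u‖ = ‖g u g'‖` for all operators `u` and all `g, g' ∈ G`, and such
that only the multiples of the identity commute with all elements of `G`. -/
def HasEnoughSymmetries (p : CNorm n) : Prop :=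
  ∃ G : Subgroup (Matrix.unitaryGroup (Fin n) ℂ),
    IsCompact (G : Set (Matrix.unitaryGroup (Fin n) ℂ)) ∧
    (∀ u : Space p →L[ℂ] Space p, ∀ g ∈ G, ∀ g' ∈ G,
      ‖u‖ = ‖matOp p (g : Matrix (Fin n) (Fin n) ℂ) ∘L u ∘L
        matOp p (g' : Matrix (Fin n) (Fin n) ℂ)‖) ∧
    (∀ u : Space p →L[ℂ] Space p,
      (∀ g ∈ G, u ∘L matOp p (g : Matrix (Fin n) (Fin n) ℂ) =
        matOp p (g : Matrix (Fin n) (Fin n) ℂ) ∘L u) →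
      ∃ c : ℂ, u = c • ContinuousLinearMap.id ℂ (Space p))

end EnoughSymm

end

namespace EnoughSymm

open MeasureTheory Matrix

variable {n : ℕ}

/-! Everything rests on one averaging fact. For a vector `a`, the Haar average of `g a aᴴ gᴴ` over
the symmetry group commutes with the group, hence is scalar, and its trace forces the scalar `‖a‖² /
n`. So the orbit of `a` contains finite weighted families arbitrarily close to a tight frame
(`exists_almost_tight_frame`), and the group acts by isometries of the norm.

Upper bound for `π₂`: let `b` represent a functional norming a vector where `‖ℓ₂ⁿ ↪ E‖` is attained.
Its orbit stays in the dual ball of `E`, so averaging bounds `π₂(E ↪ ℓ₂ⁿ)` by `√n / ‖ℓ₂ⁿ ↪ E‖`;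
compose with `ℓ₂ⁿ ↪ F`. Lower bound: test on the weighted orbit of a vector where `‖ℓ₂ⁿ ↪ F‖` is
attained.

The upper Weyl estimate is the general inequality `x_k ≤ π₂ / √k`. For the lower one, take `S`
extending a multiple of `ℓ₂ⁿ ↪ E`. An `L` of rank below `k` vanishes on a subspace of `ℓ₂ⁿ` of
dimension at least `n - k + 1`; the bound for `π₂(F ↪ ℓ₂ⁿ)`, applied to an orthonormal basis of it,
shows that the error is large. -/

theorem matOp_apply (p : CNorm n) (A : Matrix (Fin n) (Fin n) ℂ) (x : Fin n → ℂ) :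
    matOp p A (Space.ofVec p x) = Space.ofVec p (A *ᵥ x) := rfl

theorem idMap_apply (p q : CNorm n) (x : Fin n → ℂ) :
    idMap p q (Space.ofVec p x) = Space.ofVec q x := rfl

theorem idMapL2_apply (p : CNorm n) (x : Fin n → ℂ) :
    idMapL2 p (WithLp.toLp 2 x) = Space.ofVec p x := rfl

/-! ### Averaging over the symmetry group -/

section Average

open scoped Matrix.Norms.L2Operator

/-- The average of `g A gᴴ` over a compact group of unitary matrices lies in the closed convex
hull of the orbit of `A`, commutes with the group, and has the same trace as `A`. -/
theorem exists_average (G : Subgroup (Matrix.unitaryGroup (Fin n) ℂ))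
    (hG : IsCompact (G : Set (Matrix.unitaryGroup (Fin n) ℂ))) (A : Matrix (Fin n) (Fin n) ℂ) :
    ∃ M ∈ closure (convexHull ℝ
        (Set.range fun g : G => (g : Matrix (Fin n) (Fin n) ℂ) * A * star (g : Matrix _ _ ℂ))),
      (∀ h ∈ G, M * (h : Matrix (Fin n) (Fin n) ℂ) = (h : Matrix (Fin n) (Fin n) ℂ) * M) ∧
      M.trace = A.trace := by
  have : CompactSpace G := isCompact_iff_compactSpace.mp hG
  let _ : MeasurableSpace G := borel G
  have : BorelSpace G := ⟨rfl⟩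
  let μ : Measure G := Measure.haarMeasure ⊤
  have : IsProbabilityMeasure μ := ⟨by
    simpa using Measure.haarMeasure_self (K₀ := (⊤ : TopologicalSpace.PositiveCompacts G))⟩
  let f : G → Matrix (Fin n) (Fin n) ℂ :=
    fun g => (g : Matrix (Fin n) (Fin n) ℂ) * A * star (g : Matrix (Fin n) (Fin n) ℂ)
  have hcont : Continuous f := by
    have h : Continuous fun g : G => (g : Matrix (Fin n) (Fin n) ℂ) :=
      continuous_subtype_val.comp continuous_subtype_val
    exact (h.mul continuous_const).mul h.star
  have hint : Integrable f μ := hcont.integrable_of_hasCompactSupport (.of_compactSpace f)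
  have hu (h : Matrix.unitaryGroup (Fin n) ℂ) :
      star (h : Matrix (Fin n) (Fin n) ℂ) * (h : Matrix (Fin n) (Fin n) ℂ) = 1 :=
    Unitary.coe_star_mul_self h
  refine ⟨∫ g, f g ∂μ, ?_, ?_, ?_⟩
  · exact (convex_convexHull ℝ _).closure.integral_mem isClosed_closure
      (.of_forall fun g => subset_closure (subset_convexHull ℝ _ ⟨g, rfl⟩)) hint
  · intro h hh
    -- Left invariance of Haar measure: replacing `g` by `h g` conjugates the integrand by `h`.
    have h1 : ∫ g, f g ∂μ = (h : Matrix (Fin n) (Fin n) ℂ) * (∫ g, f g ∂μ) *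
        star (h : Matrix (Fin n) (Fin n) ℂ) := by
      rw [← integral_const_mul_of_integrable hint, ← integral_mul_const_of_integrable
        (hint.const_mul _), ← integral_mul_left_eq_self f (⟨h, hh⟩ : G)]
      refine integral_congr_ae (.of_forall fun g => ?_)
      simp [f, mul_assoc]
    calc (∫ g, f g ∂μ) * (h : Matrix (Fin n) (Fin n) ℂ)
        = (h : Matrix (Fin n) (Fin n) ℂ) * (∫ g, f g ∂μ) *
          star (h : Matrix (Fin n) (Fin n) ℂ) * (h : Matrix (Fin n) (Fin n) ℂ) := by rw [← h1]
      _ = _ := by rw [mul_assoc, hu, mul_one]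
  · have h1 := ((Matrix.traceLinearMap (Fin n) ℂ ℂ).toContinuousLinearMap).integral_comp_comm hint
    simp only [LinearMap.coe_toContinuousLinearMap', Matrix.traceLinearMap_apply] at h1
    rw [← h1]
    have h2 (g : G) : (f g).trace = A.trace := by
      simp only [f]
      rw [Matrix.trace_mul_comm, ← mul_assoc, hu, one_mul]
    simp [h2]

theorem norm_star_dotProduct_mulVec_le (A : Matrix (Fin n) (Fin n) ℂ) (x : Fin n → ℂ) :
    ‖star x ⬝ᵥ A *ᵥ x‖ ≤ ‖A‖ * ‖WithLp.toLp 2 x‖ ^ 2 := by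
  have h := norm_inner_le_norm (𝕜 := ℂ) (WithLp.toLp 2 x) (WithLp.toLp 2 (A *ᵥ x))
  rw [EuclideanSpace.inner_eq_star_dotProduct, dotProduct_comm] at h
  have h2 := Matrix.l2_opNorm_mulVec A (WithLp.toLp 2 x)
  calc _ ≤ _ := h
    _ ≤ ‖WithLp.toLp 2 x‖ * (‖A‖ * ‖WithLp.toLp 2 x‖) := by gcongr; exact h2
    _ = _ := by ring

end Average

/-! ### Rank-one matrices and almost tight frames -/

theorem star_dotProduct_self (x : Fin n → ℂ) :
    star x ⬝ᵥ x = ((‖WithLp.toLp 2 x‖ ^ 2 : ℝ) : ℂ) := by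
  have h := inner_self_eq_norm_sq_to_K (𝕜 := ℂ) (WithLp.toLp 2 x)
  rw [EuclideanSpace.inner_eq_star_dotProduct, dotProduct_comm] at h
  rw [h]; simp

theorem star_dotProduct_vecMulVec (b x : Fin n → ℂ) :
    star x ⬝ᵥ vecMulVec b (star b) *ᵥ x = ((‖star b ⬝ᵥ x‖ ^ 2 : ℝ) : ℂ) := by
  rw [vecMulVec_mulVec, op_smul_eq_smul, dotProduct_smul, smul_eq_mul]
  have h : star x ⬝ᵥ b = star (star b ⬝ᵥ x) := by rw [star_dotProduct]
  rw [h]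
  simpa using Complex.mul_conj' (star b ⬝ᵥ x)

theorem mul_vecMulVec_mul_star (A : Matrix (Fin n) (Fin n) ℂ) (a : Fin n → ℂ) :
    A * vecMulVec a (star a) * star A = vecMulVec (A *ᵥ a) (star (A *ᵥ a)) := by
  rw [mul_vecMulVec, vecMulVec_mul, star_mulVec, star_eq_conjTranspose]

theorem matrix_eq_smul_one {p : CNorm n} {M : Matrix (Fin n) (Fin n) ℂ} {c : ℂ}
    (h : matOp p M = c • ContinuousLinearMap.id ℂ (Space p)) : M = c • 1 := by
  refine Matrix.ext_of_mulVec_single fun i => ?_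
  have := congrArg (Space.ofVec p).symm (DFunLike.congr_fun h (Space.ofVec p (Pi.single i 1)))
  rw [matOp_apply] at this
  rw [smul_mulVec, one_mulVec]
  exact this

/-- Taking `u = id` and `g' = 1` in the hypothesis makes every `g` a contraction; the same holds for
`g⁻¹`. -/
theorem seminorm_mulVec_of_isometry (p : CNorm n) {G : Subgroup (Matrix.unitaryGroup (Fin n) ℂ)}
    (hG : ∀ u : Space p →L[ℂ] Space p, ∀ g ∈ G, ∀ g' ∈ G,
      ‖u‖ = ‖matOp p (g : Matrix (Fin n) (Fin n) ℂ) ∘L u ∘L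
        matOp p (g' : Matrix (Fin n) (Fin n) ℂ)‖)
    {g : Matrix.unitaryGroup (Fin n) ℂ} (hg : g ∈ G) (x : Fin n → ℂ) :
    p.toSeminorm ((g : Matrix (Fin n) (Fin n) ℂ) *ᵥ x) = p.toSeminorm x := by
  have key : ∀ g ∈ G, ∀ x : Fin n → ℂ,
      p.toSeminorm ((g : Matrix (Fin n) (Fin n) ℂ) *ᵥ x) ≤ p.toSeminorm x := by
    intro g hg x
    have h1 := hG (.id ℂ _) g hg 1 G.one_mem
    have h2 : matOp p ((1 : Matrix.unitaryGroup (Fin n) ℂ) : Matrix (Fin n) (Fin n) ℂ)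
        = .id ℂ _ := by
      ext x
      exact Matrix.one_mulVec (α := ℂ) (m := Fin n) x
    rw [h2] at h1
    simp only [ContinuousLinearMap.comp_id] at h1
    exact (matOp p (g : Matrix (Fin n) (Fin n) ℂ)).le_of_opNorm_le
      (h1 ▸ ContinuousLinearMap.norm_id_le) (Space.ofVec p x) |>.trans (one_mul _).le
  refine le_antisymm (key g hg x) ?_
  have h3 := key g⁻¹ (G.inv_mem hg) ((g : Matrix (Fin n) (Fin n) ℂ) *ᵥ x)
  rwa [mulVec_mulVec, ← Submonoid.coe_mul, inv_mul_cancel, OneMemClass.coe_one,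
    one_mulVec] at h3

open scoped Matrix.Norms.L2Operator in
/-- The orbit of a vector under the symmetry group contains a finite weighted family that is
arbitrarily close to a tight frame. -/
theorem HasEnoughSymmetries.exists_almost_tight_frame {p : CNorm n} (hp : HasEnoughSymmetries p)
    (hn : 0 < n) (a : Fin n → ℂ) {ε : ℝ} (hε : 0 < ε) :
    ∃ (m : ℕ) (w : Fin m → ℝ) (g : Fin m → Matrix.unitaryGroup (Fin n) ℂ),
      (∀ i, 0 ≤ w i) ∧ ∑ i, w i = 1 ∧
      (∀ i x, p.toSeminorm ((g i : Matrix (Fin n) (Fin n) ℂ) *ᵥ x) = p.toSeminorm x) ∧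
      ∀ x : Fin n → ℂ,
        |∑ i, w i * ‖star ((g i : Matrix (Fin n) (Fin n) ℂ) *ᵥ a) ⬝ᵥ x‖ ^ 2 -
          ‖WithLp.toLp 2 a‖ ^ 2 / n * ‖WithLp.toLp 2 x‖ ^ 2| ≤ ε * ‖WithLp.toLp 2 x‖ ^ 2 := by
  obtain ⟨G, hGc, hGi, hGs⟩ := hp
  obtain ⟨M, hM, hcomm, htr⟩ := exists_average G hGc (vecMulVec a (star a))
  obtain ⟨c, hc⟩ := hGs (matOp p M) fun g hg => by
    refine ContinuousLinearMap.ext fun y => ?_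
    obtain ⟨x, rfl⟩ := (Space.ofVec p).surjective y
    simp only [ContinuousLinearMap.comp_apply, matOp_apply, mulVec_mulVec, hcomm g hg]
  have hMc := matrix_eq_smul_one hc
  have hcv : c = ((‖WithLp.toLp 2 a‖ ^ 2 / n : ℝ) : ℂ) := by
    rw [hMc, trace_smul, trace_one, trace_vecMulVec, dotProduct_comm,
      star_dotProduct_self] at htr
    have : (n : ℂ) ≠ 0 := by exact_mod_cast hn.ne'
    push_cast at htr ⊢
    rw [eq_div_iff this, ← htr]
    simp
  -- A finite convex combination `N` of orbit points replaces the integral `M`, at the cost of `ε`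
  -- in operator norm and hence of `ε ‖x‖²` in the quadratic form.
  obtain ⟨N, hN, hdist⟩ := Metric.mem_closure_iff.mp hM ε hε
  obtain ⟨ι, _, w, z, hw0, hw1, hz, hsum⟩ := mem_convexHull_iff_exists_fintype.mp hN
  choose g hg using hz
  let e := (Fintype.equivFin ι).symm
  refine ⟨Fintype.card ι, w ∘ e, fun i => g (e i), fun i => hw0 _, ?_,
    fun i x => seminorm_mulVec_of_isometry p hGi (g (e i)).2 x, fun x => ?_⟩
  · rw [← hw1]; exact e.sum_comp w
  · have h1 : ((∑ i, (w ∘ e) i *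
        ‖star ((g (e i) : Matrix (Fin n) (Fin n) ℂ) *ᵥ a) ⬝ᵥ x‖ ^ 2 : ℝ) : ℂ) =
        star x ⬝ᵥ N *ᵥ x := by
      rw [← hsum, sum_mulVec, dotProduct_sum]
      push_cast
      rw [← e.sum_comp]
      refine Finset.sum_congr rfl fun i _ => ?_
      rw [← hg (e i)]
      simp only [Function.comp]
      rw [mul_vecMulVec_mul_star, smul_mulVec, dotProduct_smul, star_dotProduct_vecMulVec]
      simp
    have h2 : ((‖WithLp.toLp 2 a‖ ^ 2 / n * ‖WithLp.toLp 2 x‖ ^ 2 : ℝ) : ℂ) =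
        star x ⬝ᵥ M *ᵥ x := by
      rw [hMc, smul_mulVec, one_mulVec, dotProduct_smul, star_dotProduct_self, hcv,
        smul_eq_mul, Complex.ofReal_mul]
    rw [← Real.norm_eq_abs, ← Complex.norm_real, Complex.ofReal_sub]
    refine (congrArg norm (congrArg₂ (· - ·) h1 h2)).trans_le ?_
    rw [← dotProduct_sub, ← sub_mulVec]
    refine (norm_star_dotProduct_mulVec_le _ _).trans ?_
    rw [dist_eq_norm, norm_sub_rev] at hdist
    gcongr

end EnoughSymm

namespace EnoughSymm

/-! ### Two-summing bounds and Weyl numbers of general operators -/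

section WeakNorm

variable {E F H : Type*} [NormedAddCommGroup E] [NormedSpace ℂ E]
  [NormedAddCommGroup F] [NormedSpace ℂ F]
  [NormedAddCommGroup H] [InnerProductSpace ℂ H]

theorem weakTwoNorm_nonneg {m : ℕ} (x : Fin m → E) : 0 ≤ weakTwoNorm x :=
  Real.iSup_nonneg fun _ => Real.sqrt_nonneg _

theorem sum_norm_sq_le_weakTwoNorm_sq {m : ℕ} (x : Fin m → E) {φ : StrongDual ℂ E}
    (hφ : ‖φ‖ ≤ 1) : ∑ i, ‖φ (x i)‖ ^ 2 ≤ weakTwoNorm x ^ 2 := by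
  have hbdd : BddAbove (Set.range fun φ : Metric.closedBall (0 : StrongDual ℂ E) 1 =>
      √(∑ i, ‖(φ : StrongDual ℂ E) (x i)‖ ^ 2)) := by
    refine ⟨√(∑ i, ‖x i‖ ^ 2), ?_⟩
    rintro _ ⟨ψ, rfl⟩
    refine Real.sqrt_le_sqrt (Finset.sum_le_sum fun i _ => ?_)
    gcongr
    simpa using (ψ : StrongDual ℂ E).le_of_opNorm_le (mem_closedBall_zero_iff.mp ψ.2) (x i)
  exact (Real.sqrt_le_left (weakTwoNorm_nonneg x)).mp
    (le_ciSup hbdd ⟨φ, mem_closedBall_zero_iff.mpr hφ⟩)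

theorem weakTwoNorm_le {m : ℕ} {x : Fin m → E} {C : ℝ} (hC : 0 ≤ C)
    (h : ∀ φ : StrongDual ℂ E, ‖φ‖ ≤ 1 → ∑ i, ‖φ (x i)‖ ^ 2 ≤ C ^ 2) : weakTwoNorm x ≤ C :=
  Real.iSup_le (fun φ => (Real.sqrt_le_left hC).mpr
    (h φ (mem_closedBall_zero_iff.mp φ.2))) hC

/-- Bessel's inequality for the Riesz vector of `φ ∘ S`. -/
theorem weakTwoNorm_comp_orthonormal_le [CompleteSpace H] (S : H →L[ℂ] E) {m : ℕ} {e : Fin m → H}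
    (he : Orthonormal ℂ e) : weakTwoNorm (fun i => S (e i)) ≤ ‖S‖ := by
  refine weakTwoNorm_le (norm_nonneg S) fun φ hφ => ?_
  let v := (InnerProductSpace.toDual ℂ H).symm (φ ∘L S)
  have hv : ‖v‖ ≤ ‖S‖ := by
    rw [LinearIsometryEquiv.norm_map]
    exact (φ.opNorm_comp_le S).trans (mul_le_of_le_one_left (norm_nonneg S) hφ)
  calc ∑ i, ‖φ (S (e i))‖ ^ 2 = ∑ i, ‖inner ℂ (e i) v‖ ^ 2 := by
        refine Finset.sum_congr rfl fun i _ => ?_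
        rw [norm_inner_symm, InnerProductSpace.toDual_symm_apply]
        rfl
    _ ≤ ‖v‖ ^ 2 := he.sum_inner_products_le v
    _ ≤ ‖S‖ ^ 2 := by gcongr

theorem IsTwoSummingBound.sum_le {T : E →L[ℂ] F} {ρ : ℝ} (h : IsTwoSummingBound T ρ) {m : ℕ}
    (x : Fin m → E) : ∑ i, ‖T (x i)‖ ^ 2 ≤ (ρ * weakTwoNorm x) ^ 2 :=
  (Real.sqrt_le_left (mul_nonneg h.1 (weakTwoNorm_nonneg x))).mp (h.2 m x)

theorem approxNumber_le_norm {k : ℕ} (T L : E →L[ℂ] F)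
    (hL : LinearMap.rank (L : E →ₗ[ℂ] F) < (k : Cardinal)) : approxNumber k T ≤ ‖T - L‖ :=
  csInf_le ⟨0, by rintro _ ⟨L, -, rfl⟩; exact norm_nonneg _⟩ ⟨L, hL, rfl⟩

theorem le_approxNumber {k : ℕ} (hk : 1 ≤ k) {T : E →L[ℂ] F} {t : ℝ}
    (h : ∀ L : E →L[ℂ] F, LinearMap.rank (L : E →ₗ[ℂ] F) < (k : Cardinal) → t ≤ ‖T - L‖) :
    t ≤ approxNumber k T := by
  refine le_csInf ⟨_, 0, ?_, rfl⟩ ?_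
  · rw [ContinuousLinearMap.toLinearMap_zero, LinearMap.rank_zero]
    exact_mod_cast hk
  · rintro _ ⟨L, hL, rfl⟩
    exact h L hL

/-- An operator on a Hilbert space is large on an orthonormal family of length `k`, compared with
its `k`-th approximation number. -/
theorem exists_orthonormal_lt_norm {k : ℕ} (R : H →L[ℂ] F) {t : ℝ} (ht : 0 ≤ t)
    (h : t < approxNumber k R) (j : ℕ) (hj : j ≤ k) :
    ∃ e : Fin j → H, Orthonormal ℂ e ∧ ∀ i, t ≤ ‖R (e i)‖ := by
  induction j with
  | zero => exact ⟨Fin.elim0, ⟨fun i => i.elim0, fun i => i.elim0⟩, fun i => i.elim0⟩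
  | succ j ih =>
    obtain ⟨e, he, hR⟩ := ih (by omega)
    let V := Submodule.span ℂ (Set.range e)
    have : FiniteDimensional ℂ V := FiniteDimensional.span_of_finite ℂ (Set.finite_range e)
    let P : H →L[ℂ] H := V.starProjection
    -- `R P` has rank at most `j < k`, so it competes in `a_k(R)`. Hence `R - R P` has norm above
    -- `t`, which yields the next vector orthogonal to `V`.
    have hrank : LinearMap.rank ((R ∘L P : H →L[ℂ] F) : H →ₗ[ℂ] F) < (k : Cardinal) := by
      have h1 : LinearMap.rank (P : H →ₗ[ℂ] H) ≤ (j : Cardinal) := by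
        have h2 : LinearMap.range (P : H →ₗ[ℂ] H) = V := V.range_starProjection
        rw [LinearMap.rank, h2]
        refine (rank_span_le _).trans ?_
        simpa using Cardinal.mk_range_le_lift (f := e)
      have h3 := LinearMap.lift_rank_comp_le_right (P : H →ₗ[ℂ] H) (R : H →ₗ[ℂ] F)
      have h4 := h3.trans (Cardinal.lift_le.mpr h1)
      rw [Cardinal.lift_natCast, Cardinal.lift_le_nat_iff] at h4
      refine h4.trans_lt ?_
      exact_mod_cast hj
    have hnorm := h.trans_le (approxNumber_le_norm R (R ∘L P) hrank)
    obtain ⟨z, hz⟩ : ∃ z, t * ‖z‖ < ‖(R - R ∘L P) z‖ := by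
      by_contra! hcon
      exact hnorm.not_ge (ContinuousLinearMap.opNorm_le_bound _ ht hcon)
    let v := z - P z
    have hv : v ∈ Vᗮ := V.sub_starProjection_mem_orthogonal z
    have hvn : ‖v‖ ≤ ‖z‖ := by
      have := Vᗮ.norm_starProjection_apply_le z
      rwa [Submodule.starProjection_orthogonal_val] at this
    have hRv : t * ‖v‖ < ‖R v‖ := by
      have h3 : R v = (R - R ∘L P) z := by simp [v]
      rw [h3]
      exact lt_of_le_of_lt (by gcongr) hz
    have hv0 : v ≠ 0 := by
      rintro h0
      simp [h0] at hRv
    have hvpos : 0 < ‖v‖ := norm_pos_iff.mpr hv0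
    refine ⟨Fin.snoc e (((‖v‖⁻¹ : ℝ) : ℂ) • v), ?_, ?_⟩
    · have horth (i : Fin j) : inner ℂ (e i) v = 0 :=
        hv (e i) (Submodule.subset_span ⟨i, rfl⟩)
      constructor
      · intro i
        refine Fin.lastCases ?_ (fun i => ?_) i
        · rw [Fin.snoc_last, norm_smul, Complex.norm_real, norm_inv, norm_norm,
            inv_mul_cancel₀ hvpos.ne']
        · rw [Fin.snoc_castSucc]; exact he.1 i
      · intro i i' hii
        induction i using Fin.lastCases with
        | last =>
          induction i' using Fin.lastCases with
          | last => exact absurd rfl hii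
          | cast i' =>
            rw [Fin.snoc_last, Fin.snoc_castSucc, inner_smul_left, ← inner_conj_symm, horth]
            simp
        | cast i =>
          induction i' using Fin.lastCases with
          | last => rw [Fin.snoc_last, Fin.snoc_castSucc, inner_smul_right, horth, mul_zero]
          | cast i' =>
            rw [Fin.snoc_castSucc, Fin.snoc_castSucc]
            exact he.2 fun hc => hii (by rw [hc])
    · intro i
      refine Fin.lastCases ?_ (fun i => ?_) i
      · rw [Fin.snoc_last, map_smul, norm_smul, Complex.norm_real, norm_inv, norm_norm,
          ← div_eq_inv_mul, le_div_iff₀ hvpos]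
        exact hRv.le
      · rw [Fin.snoc_castSucc]; exact hR i

/-- If `t < a_k(T S)`, some orthonormal `e₁, …, e_k` satisfy `‖T S eᵢ‖ ≥ t`. The family `S eᵢ` has
weak norm at most `1`, so `k t² ≤ ρ²`. -/
theorem approxNumber_comp_le_of_isTwoSummingBound [CompleteSpace H] {T : E →L[ℂ] F} {ρ : ℝ}
    (h : IsTwoSummingBound T ρ) {k : ℕ} (hk : 1 ≤ k) (S : H →L[ℂ] E) (hS : ‖S‖ ≤ 1) :
    approxNumber k (T ∘L S) ≤ ρ / √k := by
  have hkpos : (0 : ℝ) < k := by exact_mod_cast hk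
  by_contra! hcon
  obtain ⟨t, hρt, hta⟩ := exists_between hcon
  have ht : 0 ≤ t := (div_nonneg h.1 (Real.sqrt_nonneg _)).trans hρt.le
  obtain ⟨e, he, hTe⟩ := exists_orthonormal_lt_norm (T ∘L S) ht hta k le_rfl
  have h1 : k * t ^ 2 ≤ ρ ^ 2 := by
    calc k * t ^ 2 = ∑ _i : Fin k, t ^ 2 := by simp
      _ ≤ ∑ i, ‖T (S (e i))‖ ^ 2 := by gcongr with i; exact hTe i
      _ ≤ (ρ * weakTwoNorm fun i => S (e i)) ^ 2 := h.sum_le _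
      _ ≤ (ρ * 1) ^ 2 := by
        have := weakTwoNorm_nonneg fun i => S (e i)
        have := h.1
        gcongr
        exact (weakTwoNorm_comp_orthonormal_le S he).trans hS
      _ = ρ ^ 2 := by rw [mul_one]
  rw [div_lt_iff₀ (Real.sqrt_pos.mpr hkpos)] at hρt
  have h2 : ρ ^ 2 < (t * √k) ^ 2 := pow_lt_pow_left₀ hρt h.1 two_ne_zero
  rw [mul_pow, Real.sq_sqrt hkpos.le] at h2
  linarith

theorem weylNumber_le_of_isTwoSummingBound {T : E →L[ℂ] F} {ρ : ℝ}
    (h : IsTwoSummingBound T ρ) {k : ℕ} (hk : 1 ≤ k) : weylNumber k T ≤ ρ / √k := by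
  refine Real.sSup_le ?_ (div_nonneg h.1 (Real.sqrt_nonneg _))
  rintro _ ⟨S, hS, rfl⟩
  exact approxNumber_comp_le_of_isTwoSummingBound h hk S hS.le

/-- The two-summing hypothesis supplies the upper bound that makes the supremum a genuine one. -/
theorem approxNumber_comp_le_weylNumber {T : E →L[ℂ] F} (h : IsTwoSumming T) {k : ℕ}
    (hk : 1 ≤ k) {S : EllTwo →L[ℂ] E} (hS : ‖S‖ = 1) :
    approxNumber k (T ∘L S) ≤ weylNumber k T := by
  obtain ⟨ρ, hρ⟩ := h
  refine le_csSup ⟨ρ / √k, ?_⟩ ⟨S, hS, rfl⟩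
  rintro _ ⟨S, hS, rfl⟩
  exact approxNumber_comp_le_of_isTwoSummingBound hρ hk S hS.le

end WeakNorm

end EnoughSymm

namespace EnoughSymm

open Matrix

variable {n : ℕ}

/-! ### Two-summing norms of identity maps -/

theorem le_of_forall_pos_le_add_mul {A B C : ℝ} (h : ∀ ε > 0, A ≤ B + ε * C) : A ≤ B := by
  have hlim : Filter.Tendsto (fun ε : ℝ => B + ε * C) (nhdsWithin 0 (Set.Ioi 0)) (nhds B) := by
    have : Continuous fun ε : ℝ => B + ε * C := by fun_prop
    simpa using (this.tendsto 0).mono_left nhdsWithin_le_nhds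
  exact ge_of_tendsto hlim (eventually_nhdsWithin_of_forall h)

theorem norm_star_dotProduct_le (a x : Fin n → ℂ) :
    ‖star a ⬝ᵥ x‖ ≤ ‖WithLp.toLp 2 a‖ * ‖WithLp.toLp 2 x‖ := by
  have h := norm_inner_le_norm (𝕜 := ℂ) (WithLp.toLp 2 a) (WithLp.toLp 2 x)
  rwa [EuclideanSpace.inner_eq_star_dotProduct, dotProduct_comm] at h

theorem norm_star_dotProduct_comm (a x : Fin n → ℂ) : ‖star a ⬝ᵥ x‖ = ‖star x ⬝ᵥ a‖ := by
  rw [star_dotProduct, norm_star]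

/-- A functional in the dual unit ball of `(ℂⁿ, p)` is represented by a vector whose Euclidean
norm is at most `‖ℓ₂ⁿ ↪ (ℂⁿ, p)‖`. -/
theorem exists_dual_eq_star_dotProduct (p : CNorm n) (φ : StrongDual ℂ (Space p)) (hφ : ‖φ‖ ≤ 1) :
    ∃ b : Fin n → ℂ, (∀ x, φ (Space.ofVec p x) = star b ⬝ᵥ x) ∧
      ‖WithLp.toLp 2 b‖ ≤ ‖idMapL2 p‖ := by
  let v := (InnerProductSpace.toDual ℂ (EuclideanSpace ℂ (Fin n))).symm (φ ∘L idMapL2 p)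
  refine ⟨v.ofLp, fun x => ?_, ?_⟩
  · have h := InnerProductSpace.toDual_symm_apply (𝕜 := ℂ) (x := WithLp.toLp 2 x)
      (y := φ ∘L idMapL2 p)
    rw [EuclideanSpace.inner_eq_star_dotProduct, dotProduct_comm] at h
    exact h.symm
  · change ‖v‖ ≤ _
    rw [LinearIsometryEquiv.norm_map]
    exact (φ.opNorm_comp_le _).trans (mul_le_of_le_one_left (norm_nonneg _) hφ)

theorem exists_norm_idMapL2_eq (p : CNorm n) :
    ∃ y : Fin n → ℂ, ‖WithLp.toLp 2 y‖ ≤ 1 ∧ p.toSeminorm y = ‖idMapL2 p‖ := by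
  have hcompact := isCompact_closedBall (0 : EuclideanSpace ℂ (Fin n)) 1
  obtain ⟨y, hy, hmax⟩ := hcompact.exists_sSup_image_eq
    ⟨0, by simp⟩ (f := fun x => ‖idMapL2 p x‖) (by fun_prop)
  rw [ContinuousLinearMap.sSup_unitClosedBall_eq_norm] at hmax
  exact ⟨y.ofLp, mem_closedBall_zero_iff.mp hy, hmax.symm⟩

theorem norm_idMapL2_pos (p : CNorm n) (hn : 0 < n) : 0 < ‖idMapL2 p‖ := by
  rw [norm_pos_iff]
  intro h
  have h1 : Space.ofVec p (Pi.single ⟨0, hn⟩ 1) = 0 := by rw [← idMapL2_apply, h]; rfl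
  rw [map_eq_zero_iff _ (Space.ofVec p).injective] at h1
  simp at h1

theorem seminorm_le_norm_idMapL2_mul (p : CNorm n) (x : Fin n → ℂ) :
    p.toSeminorm x ≤ ‖idMapL2 p‖ * ‖WithLp.toLp 2 x‖ :=
  (idMapL2 p).le_opNorm (WithLp.toLp 2 x)

/-- The identity `(ℂⁿ, p) ↪ ℓ₂ⁿ` has `2`-summing norm at most `√n / ‖ℓ₂ⁿ ↪ (ℂⁿ, p)‖`. -/
theorem HasEnoughSymmetries.sum_norm_sq_le {p : CNorm n} (hp : HasEnoughSymmetries p)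
    (hn : 0 < n) {m : ℕ} (x : Fin m → Fin n → ℂ) :
    ‖idMapL2 p‖ ^ 2 * ∑ j, ‖WithLp.toLp 2 (x j)‖ ^ 2 ≤
      n * weakTwoNorm (fun j => Space.ofVec p (x j)) ^ 2 := by
  obtain ⟨y, hy, hpy⟩ := exists_norm_idMapL2_eq p
  obtain ⟨φ, hφ, hφy⟩ := exists_dual_vector'' ℂ (Space.ofVec p y)
  obtain ⟨b, hb, -⟩ := exists_dual_eq_star_dotProduct p φ hφ
  -- Cauchy–Schwarz for `⟨b, y⟩ = p(y) = ‖ℓ₂ⁿ ↪ E‖` with `‖y‖ ≤ 1`.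
  have hbn : ‖idMapL2 p‖ ≤ ‖WithLp.toLp 2 b‖ := by
    have h1 := norm_star_dotProduct_le b y
    rw [← hb, hφy, Space.norm_ofVec, hpy] at h1
    simp only [RCLike.norm_ofReal, abs_norm] at h1
    exact h1.trans (mul_le_of_le_one_right (norm_nonneg _) hy)
  have hnpos : (0 : ℝ) < n := by exact_mod_cast hn
  let W := weakTwoNorm fun j => Space.ofVec p (x j)
  let s := ∑ j, ‖WithLp.toLp 2 (x j)‖ ^ 2
  have hs : 0 ≤ s := Finset.sum_nonneg fun _ _ => sq_nonneg _
  have key : ‖WithLp.toLp 2 b‖ ^ 2 / n * s ≤ W ^ 2 := by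
    refine le_of_forall_pos_le_add_mul (C := s) fun ε hε => ?_
    obtain ⟨N, w, g, hw0, hw1, hg, hfr⟩ := hp.exists_almost_tight_frame hn b hε
    have hi (i : Fin N) :
        ∑ j, ‖star ((g i : Matrix (Fin n) (Fin n) ℂ) *ᵥ b) ⬝ᵥ x j‖ ^ 2 ≤ W ^ 2 := by
      have hu : (g i : Matrix (Fin n) (Fin n) ℂ) * star (g i : Matrix (Fin n) (Fin n) ℂ) = 1 :=
        Unitary.coe_mul_star_self (g i)
      have hstar : ‖matOp p (star (g i : Matrix (Fin n) (Fin n) ℂ))‖ ≤ 1 := by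
        refine ContinuousLinearMap.opNorm_le_bound _ zero_le_one fun z => ?_
        obtain ⟨z, rfl⟩ := (Space.ofVec p).surjective z
        rw [matOp_apply, Space.norm_ofVec, Space.norm_ofVec, one_mul, ← hg i, mulVec_mulVec, hu,
          one_mulVec]
      -- The functional `φ ∘ gᴴ` is represented by `g b` and stays in the dual unit ball, since `gᴴ
      -- = g⁻¹` is a contraction for `p`.
      have h1 := sum_norm_sq_le_weakTwoNorm_sq (fun j => Space.ofVec p (x j))
        (φ := φ ∘L matOp p (star (g i : Matrix (Fin n) (Fin n) ℂ)))
        ((φ.opNorm_comp_le _).trans (mul_le_one₀ hφ (norm_nonneg _) hstar))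
      refine le_of_eq_of_le (Finset.sum_congr rfl fun j _ => ?_) h1
      rw [ContinuousLinearMap.comp_apply, matOp_apply, hb, star_mulVec, ← dotProduct_mulVec,
        star_eq_conjTranspose]
    calc ‖WithLp.toLp 2 b‖ ^ 2 / n * s
        ≤ ∑ j, (∑ i, w i * ‖star ((g i : Matrix (Fin n) (Fin n) ℂ) *ᵥ b) ⬝ᵥ x j‖ ^ 2 +
            ε * ‖WithLp.toLp 2 (x j)‖ ^ 2) := by
          rw [Finset.mul_sum]
          refine Finset.sum_le_sum fun j _ => ?_
          linarith [(abs_le.mp (hfr (x j))).1]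
      _ = ∑ i, w i * ∑ j, ‖star ((g i : Matrix (Fin n) (Fin n) ℂ) *ᵥ b) ⬝ᵥ x j‖ ^ 2 + ε * s := by
          simp_rw [Finset.sum_add_distrib, s, Finset.mul_sum]
          rw [Finset.sum_comm]
      _ ≤ ∑ i, w i * W ^ 2 + ε * s := by
          gcongr with i
          · exact hw0 i
          · exact hi i
      _ = W ^ 2 + ε * s := by rw [← Finset.sum_mul, hw1, one_mul]
  have h2 : ‖WithLp.toLp 2 b‖ ^ 2 * s ≤ n * W ^ 2 := by
    rw [div_mul_eq_mul_div, div_le_iff₀ hnpos] at key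
    linarith
  exact (mul_le_mul_of_nonneg_right (pow_le_pow_left₀ (norm_nonneg _) hbn 2) hs).trans h2

/-- Factor the identity through `ℓ₂ⁿ`. -/
theorem HasEnoughSymmetries.isTwoSummingBound_idMap {p : CNorm n} (hp : HasEnoughSymmetries p)
    (q : CNorm n) (hn : 0 < n) :
    IsTwoSummingBound (idMap p q) (√(n : ℝ) * (‖idMapL2 q‖ / ‖idMapL2 p‖)) := by
  refine ⟨by positivity, fun m x => ?_⟩
  have hW := weakTwoNorm_nonneg x
  refine Real.sqrt_le_iff.mpr ⟨by positivity, ?_⟩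
  have hpos := norm_idMapL2_pos p hn
  have h1 := hp.sum_norm_sq_le hn (fun j => (Space.ofVec p).symm (x j))
  simp only [LinearEquiv.apply_symm_apply] at h1
  have h2 : ∑ i, ‖idMap p q (x i)‖ ^ 2 ≤
      ‖idMapL2 q‖ ^ 2 * ∑ i, ‖WithLp.toLp 2 ((Space.ofVec p).symm (x i))‖ ^ 2 := by
    rw [Finset.mul_sum]
    refine Finset.sum_le_sum fun i _ => ?_
    rw [← mul_pow]
    gcongr
    exact seminorm_le_norm_idMapL2_mul q _
  refine h2.trans ?_
  rw [mul_pow, mul_pow, Real.sq_sqrt n.cast_nonneg, div_pow]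
  calc _ = ‖idMapL2 q‖ ^ 2 / ‖idMapL2 p‖ ^ 2 * (‖idMapL2 p‖ ^ 2 *
        ∑ i, ‖WithLp.toLp 2 ((Space.ofVec p).symm (x i))‖ ^ 2) := by field_simp
    _ ≤ ‖idMapL2 q‖ ^ 2 / ‖idMapL2 p‖ ^ 2 * (n * weakTwoNorm x ^ 2) := by gcongr
    _ = _ := by ring

theorem HasEnoughSymmetries.le_of_isTwoSummingBound {q : CNorm n} (hq : HasEnoughSymmetries q)
    (p : CNorm n) (hn : 0 < n) {ρ : ℝ} (hρ : IsTwoSummingBound (idMap p q) ρ) :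
    √(n : ℝ) * (‖idMapL2 q‖ / ‖idMapL2 p‖) ≤ ρ := by
  obtain ⟨y, hy, hqy⟩ := exists_norm_idMapL2_eq q
  have hnpos : (0 : ℝ) < n := by exact_mod_cast hn
  have hpos := norm_idMapL2_pos p hn
  have key : ‖idMapL2 q‖ ^ 2 ≤ ρ ^ 2 * (‖idMapL2 p‖ ^ 2 / n) := by
    refine le_of_forall_pos_le_add_mul (C := ρ ^ 2 * ‖idMapL2 p‖ ^ 2) fun ε hε => ?_
    obtain ⟨N, w, g, hw0, hw1, hg, hfr⟩ := hq.exists_almost_tight_frame hn y hε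
    -- The square roots turn sums of squares into `w`-averages: the strong sum is exactly `‖ℓ₂ⁿ ↪
    -- F‖²`, while the frame estimate makes the squared weak norm at most `(1/n + ε) ‖ℓ₂ⁿ ↪ E‖²`.
    let x : Fin N → Fin n → ℂ := fun i => ((√(w i) : ℝ) : ℂ) • (g i : Matrix _ _ ℂ) *ᵥ y
    have hweak : weakTwoNorm (fun i => Space.ofVec p (x i)) ≤
        √((1 / n + ε) * ‖idMapL2 p‖ ^ 2) := by
      refine weakTwoNorm_le (Real.sqrt_nonneg _) fun φ hφ => ?_
      obtain ⟨b, hb, hbn⟩ := exists_dual_eq_star_dotProduct p φ hφ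
      rw [Real.sq_sqrt (by positivity)]
      have h1 : ∑ i, ‖φ (Space.ofVec p (x i))‖ ^ 2 =
          ∑ i, w i * ‖star ((g i : Matrix (Fin n) (Fin n) ℂ) *ᵥ y) ⬝ᵥ b‖ ^ 2 := by
        refine Finset.sum_congr rfl fun i _ => ?_
        rw [hb, dotProduct_smul, norm_smul, Complex.norm_real, mul_pow, Real.norm_eq_abs, sq_abs,
          Real.sq_sqrt (hw0 i), norm_star_dotProduct_comm]
      rw [h1]
      calc _ ≤ (‖WithLp.toLp 2 y‖ ^ 2 / n + ε) * ‖WithLp.toLp 2 b‖ ^ 2 := by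
            linarith [(abs_le.mp (hfr b)).2]
        _ ≤ (1 / n + ε) * ‖idMapL2 p‖ ^ 2 := by
            gcongr
            exact pow_le_one₀ (norm_nonneg _) hy
    have h2 : ∑ i, ‖idMap p q (Space.ofVec p (x i))‖ ^ 2 = ‖idMapL2 q‖ ^ 2 := by
      calc _ = ∑ i, w i * ‖idMapL2 q‖ ^ 2 := by
            refine Finset.sum_congr rfl fun i _ => ?_
            rw [idMap_apply, map_smul, norm_smul, Space.norm_ofVec, hg i, hqy, Complex.norm_real,
              mul_pow, Real.norm_eq_abs, sq_abs, Real.sq_sqrt (hw0 i)]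
        _ = _ := by rw [← Finset.sum_mul, hw1, one_mul]
    have h3 := hρ.sum_le fun i => Space.ofVec p (x i)
    rw [h2] at h3
    calc _ ≤ _ := h3
      _ ≤ (ρ * √((1 / n + ε) * ‖idMapL2 p‖ ^ 2)) ^ 2 := by
        have := weakTwoNorm_nonneg fun i => Space.ofVec p (x i)
        have := hρ.1
        gcongr
      _ = _ := by
        rw [mul_pow, Real.sq_sqrt (by positivity)]
        ring
  refine le_of_sq_le_sq ?_ hρ.1
  rw [mul_pow, Real.sq_sqrt hnpos.le, div_pow, mul_div_assoc', div_le_iff₀ (by positivity)]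
  rw [mul_div_assoc', le_div_iff₀ hnpos] at key
  linarith

/-- Approximation numbers of multiples of `ℓ₂ⁿ ↪ (ℂⁿ, q)` are bounded below. -/
theorem HasEnoughSymmetries.le_norm_smul_idMapL2_sub {q : CNorm n} (hq : HasEnoughSymmetries q)
    (hn : 0 < n) (c : ℝ) {k : ℕ} (L : EuclideanSpace ℂ (Fin n) →L[ℂ] Space q)
    (hL : LinearMap.rank (L : EuclideanSpace ℂ (Fin n) →ₗ[ℂ] Space q) < (k : Cardinal)) :
    √(((n : ℝ) - k + 1) / n) * (c * ‖idMapL2 q‖) ≤ ‖(c : ℂ) • idMapL2 q - L‖ := by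
  set D := (c : ℂ) • idMapL2 q - L with hD
  let M := LinearMap.ker (L : EuclideanSpace ℂ (Fin n) →ₗ[ℂ] Space q)
  let e := stdOrthonormalBasis ℂ M
  have hnpos : (0 : ℝ) < n := by exact_mod_cast hn
  have hdim : (n : ℝ) - k + 1 ≤ (Module.finrank ℂ M : ℝ) := by
    have h1 := LinearMap.finrank_range_add_finrank_ker
      (L : EuclideanSpace ℂ (Fin n) →ₗ[ℂ] Space q)
    rw [finrank_euclideanSpace, Fintype.card_fin] at h1
    have h2 : Module.finrank ℂ
        (LinearMap.range (L : EuclideanSpace ℂ (Fin n) →ₗ[ℂ] Space q)) < k := by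
      rw [LinearMap.rank, ← Module.finrank_eq_rank] at hL
      exact_mod_cast hL
    have h3 : n + 1 ≤ Module.finrank ℂ M + k := by
      change _ + Module.finrank ℂ M = n at h1
      omega
    have h4 : (n : ℝ) + 1 ≤ Module.finrank ℂ M + k := by exact_mod_cast h3
    linarith
  have heM : Orthonormal ℂ fun i => (e i : EuclideanSpace ℂ (Fin n)) :=
    e.orthonormal.comp_linearIsometry M.subtypeₗᵢ
  have hDe (i) : Space.ofVec q ((c : ℂ) • (e i : EuclideanSpace ℂ (Fin n)).ofLp) =
      D (e i : EuclideanSpace ℂ (Fin n)) := by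
    have h1 : L (e i : EuclideanSpace ℂ (Fin n)) = 0 := (e i).2
    rw [hD, _root_.sub_apply, h1, sub_zero, _root_.smul_apply, map_smul]
    rfl
  -- On `ker L` the error `D` equals `c` times the identity, so these vectors are the `D eᵢ` and
  -- their weak norm is at most `‖D‖`.
  have h1 := hq.sum_norm_sq_le hn fun i => (c : ℂ) • (e i : EuclideanSpace ℂ (Fin n)).ofLp
  simp_rw [hDe] at h1
  have h2 (i) : ‖WithLp.toLp 2 ((c : ℂ) • (e i : EuclideanSpace ℂ (Fin n)).ofLp)‖ ^ 2 = c ^ 2 := by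
    rw [WithLp.toLp_smul, norm_smul, WithLp.toLp_ofLp, heM.1 i, Complex.norm_real, mul_one,
      Real.norm_eq_abs, sq_abs]
  simp_rw [h2] at h1
  rw [Finset.sum_const, Finset.card_univ, Fintype.card_fin, nsmul_eq_mul] at h1
  have h3 := weakTwoNorm_comp_orthonormal_le D heM
  have h4 : ‖idMapL2 q‖ ^ 2 * (((n : ℝ) - k + 1) * c ^ 2) ≤ n * ‖D‖ ^ 2 := by
    refine le_trans (by gcongr) (h1.trans ?_)
    have := weakTwoNorm_nonneg fun i => D (e i : EuclideanSpace ℂ (Fin n))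
    gcongr
  -- Here `k` may exceed `n`; a nonpositive radicand makes the real square root `0`.
  rcases le_or_gt ((n : ℝ) - k + 1) 0 with hneg | hkn
  · rw [Real.sqrt_eq_zero_of_nonpos (div_nonpos_of_nonpos_of_nonneg hneg hnpos.le), zero_mul]
    exact norm_nonneg _
  refine le_of_sq_le_sq ?_ (norm_nonneg _)
  rw [mul_pow, Real.sq_sqrt (by positivity), div_mul_eq_mul_div, div_le_iff₀ hnpos]
  linarith

/-! ### Passing from `ℓ₂ⁿ` to `ℓ₂`, and the lower Weyl estimate -/

theorem orthonormal_lp_single :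
    Orthonormal ℂ fun i : Fin n => (lp.single 2 (i : ℕ) (1 : ℂ) : EllTwo) := by
  rw [orthonormal_iff_ite]
  intro i j
  rw [lp.inner_single_left]
  by_cases h : i = j
  · subst h; simp
  · have h' : (i : ℕ) ≠ j := fun h' => h (Fin.ext h')
    simp [h, lp.single_apply, h']

theorem exists_linearIsometry_ellTwo (n : ℕ) :
    Nonempty (EuclideanSpace ℂ (Fin n) →ₗᵢ[ℂ] EllTwo) := by
  let b := EuclideanSpace.basisFun (Fin n) ℂ
  refine ⟨LinearMap.isometryOfOrthonormal (v := b.toBasis)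
    (b.toBasis.constr ℂ fun i => (lp.single 2 (i : ℕ) (1 : ℂ) : EllTwo)) (by simp) ?_⟩
  convert orthonormal_lp_single (n := n) using 1
  ext1 i
  exact b.toBasis.constr_basis ℂ _ i

/-- The adjoint of an isometric embedding is a norm-nonincreasing left inverse; it extends operators
from `ℓ₂ⁿ` to `ℓ₂` without raising the norm. -/
theorem exists_coisometry_ellTwo (n : ℕ) :
    ∃ (J : EuclideanSpace ℂ (Fin n) →L[ℂ] EllTwo) (P : EllTwo →L[ℂ] EuclideanSpace ℂ (Fin n)),
      ‖J‖ ≤ 1 ∧ ‖P‖ ≤ 1 ∧ P ∘L J = .id ℂ _ := by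
  obtain ⟨J⟩ := exists_linearIsometry_ellTwo n
  have hJ : ‖J.toContinuousLinearMap‖ ≤ 1 := J.norm_toContinuousLinearMap_le
  refine ⟨J.toContinuousLinearMap, ContinuousLinearMap.adjoint J.toContinuousLinearMap, hJ, ?_,
    J.toContinuousLinearMap.norm_map_iff_adjoint_comp_self.mp J.norm_map⟩
  rwa [LinearIsometryEquiv.norm_map]

theorem idMap_comp_idMapL2 (p q : CNorm n) : idMap p q ∘L idMapL2 p = idMapL2 q := rfl

/-- A norm one operator from `ℓ₂` that restricts to a multiple of `ℓ₂ⁿ ↪ (ℂⁿ, p)`. -/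
theorem exists_norm_one_comp_eq_smul_idMapL2 (p : CNorm n) (hn : 0 < n) :
    ∃ (J : EuclideanSpace ℂ (Fin n) →L[ℂ] EllTwo) (S : EllTwo →L[ℂ] Space p),
      ‖J‖ ≤ 1 ∧ ‖S‖ = 1 ∧ S ∘L J = ((‖idMapL2 p‖⁻¹ : ℝ) : ℂ) • idMapL2 p := by
  obtain ⟨J, P, hJ, hP, hPJ⟩ := exists_coisometry_ellTwo n
  have hpos := norm_idMapL2_pos p hn
  have hcomp : (idMapL2 p ∘L P) ∘L J = idMapL2 p := by
    rw [ContinuousLinearMap.comp_assoc, hPJ, ContinuousLinearMap.comp_id]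
  have hnorm : ‖idMapL2 p ∘L P‖ = ‖idMapL2 p‖ := by
    refine le_antisymm ((ContinuousLinearMap.opNorm_comp_le _ _).trans
      (mul_le_of_le_one_right (norm_nonneg _) hP)) ?_
    have h := ContinuousLinearMap.opNorm_comp_le (idMapL2 p ∘L P) J
    rw [hcomp] at h
    exact h.trans (mul_le_of_le_one_right (norm_nonneg _) hJ)
  refine ⟨J, ((‖idMapL2 p‖⁻¹ : ℝ) : ℂ) • (idMapL2 p ∘L P), hJ, ?_, ?_⟩
  · rw [norm_smul, hnorm, Complex.norm_real, norm_inv, norm_norm, inv_mul_cancel₀ hpos.ne']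
  · rw [ContinuousLinearMap.smul_comp, hcomp]

theorem HasEnoughSymmetries.le_weylNumber {p q : CNorm n} (hp : HasEnoughSymmetries p)
    (hq : HasEnoughSymmetries q) {k : ℕ} (hk : 1 ≤ k) (hn : 0 < n) :
    √(((n : ℝ) - k + 1) / n) * (‖idMapL2 q‖ / ‖idMapL2 p‖) ≤ weylNumber k (idMap p q) := by
  obtain ⟨J, S, hJ, hS, hSJ⟩ := exists_norm_one_comp_eq_smul_idMapL2 p hn
  refine le_trans ?_ (approxNumber_comp_le_weylNumber
    ⟨_, hp.isTwoSummingBound_idMap q hn⟩ hk hS)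
  refine le_approxNumber hk fun L hL => ?_
  have hLJ : LinearMap.rank ((L ∘L J : EuclideanSpace ℂ (Fin n) →L[ℂ] Space q) :
      EuclideanSpace ℂ (Fin n) →ₗ[ℂ] Space q) < (k : Cardinal) :=
    (LinearMap.rank_comp_le_left (J : EuclideanSpace ℂ (Fin n) →ₗ[ℂ] EllTwo)
      (L : EllTwo →ₗ[ℂ] Space q)).trans_lt hL
  have h1 := hq.le_norm_smul_idMapL2_sub hn ‖idMapL2 p‖⁻¹ (L ∘L J) hLJ
  have h2 : ((‖idMapL2 p‖⁻¹ : ℝ) : ℂ) • idMapL2 q - L ∘L J = (idMap p q ∘L S - L) ∘L J := by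
    rw [ContinuousLinearMap.sub_comp, ContinuousLinearMap.comp_assoc, hSJ,
      ContinuousLinearMap.comp_smul, idMap_comp_idMapL2]
  rw [h2, ← div_eq_inv_mul] at h1
  exact h1.trans ((ContinuousLinearMap.opNorm_comp_le _ _).trans
    (mul_le_of_le_one_right (norm_nonneg _) hJ))

end EnoughSymm

theorem mainTheorem7 {n : ℕ} (p q : EnoughSymm.CNorm n)
    (hp : EnoughSymm.HasEnoughSymmetries p) (hq : EnoughSymm.HasEnoughSymmetries q) :
    (EnoughSymm.IsTwoSumming (EnoughSymm.idMap p q) ∧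
      EnoughSymm.piTwo (EnoughSymm.idMap p q) =
        √(n : ℝ) * (‖EnoughSymm.idMapL2 q‖ / ‖EnoughSymm.idMapL2 p‖)) ∧
    ∀ k : ℕ, 1 ≤ k → k ≤ n →
      √(((n : ℝ) - (k : ℝ) + 1) / (n : ℝ)) *
          (‖EnoughSymm.idMapL2 q‖ / ‖EnoughSymm.idMapL2 p‖) ≤
        EnoughSymm.weylNumber k (EnoughSymm.idMap p q) ∧
      EnoughSymm.weylNumber k (EnoughSymm.idMap p q) ≤
        √((n : ℝ) / (k : ℝ)) *
          (‖EnoughSymm.idMapL2 q‖ / ‖EnoughSymm.idMapL2 p‖) := by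
  -- For `n = 0` all spaces are trivial, both sides of the `π₂` formula are `0`, and no `k` is
  -- admissible.
  rcases Nat.eq_zero_or_pos n with rfl | hn
  · have h0 : EnoughSymm.IsTwoSummingBound (EnoughSymm.idMap p q) 0 := by
      refine ⟨le_rfl, fun m x => ?_⟩
      have hx (i) : EnoughSymm.idMap p q (x i) = 0 :=
        ((EnoughSymm.Space.ofVec q).symm.map_eq_zero_iff).mp (Subsingleton.elim _ _)
      simp [hx]
    refine ⟨⟨⟨0, h0⟩, ?_⟩, fun k hk hk0 => by omega⟩
    rw [Nat.cast_zero, Real.sqrt_zero, zero_mul]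
    exact IsLeast.csInf_eq ⟨h0, fun ρ hρ => hρ.1⟩
  have hbound := hp.isTwoSummingBound_idMap q hn
  refine ⟨⟨⟨_, hbound⟩, IsLeast.csInf_eq ⟨hbound, fun ρ hρ =>
    hq.le_of_isTwoSummingBound p hn hρ⟩⟩, fun k hk _ => ⟨hp.le_weylNumber hq hk hn, ?_⟩⟩
  refine (EnoughSymm.weylNumber_le_of_isTwoSummingBound hbound hk).trans_eq ?_
  rw [Real.sqrt_div n.cast_nonneg]
  ring
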